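/- Let $d\in\mathbb N$, let $\rho$ be a positive semidefinite and $\sigma$ a positive definite complex $d\times d$ matrix, and for $\alpha,z>0$ let $$f_{\alpha,z}(\rho\|\sigma)=\operatorname{Tr}\Bigl(\sigma^{\frac{1-\alpha}{2z}}\,\rho^{\frac{\alpha}{z}}\,\sigma^{\frac{1-\alpha}{2z}}\Bigr)^{z},\qquad D_{\alpha,z}(\rho\|\sigma)=\frac1{\alpha-1}\log_2 f_{\alpha,z}(\rho\|\sigma)\quad(\operatorname{Tr}\rho=1,\ \alpha\ne1).$$ Let $\sigma=U\operatorname{diag}(\lambda_1,\dots,\lambda_d)U^*$ with $U$ unitary and $\lambda_1\ge\lambda_2\ge\dots\ge\lambda_d$ (multiplicities are allowed), and let $\Pi_\rho$ be the orthogonal projection onto the support $(\ker\rho)^\perp$ of $\rho$. A row echelon form of a $d\times d$ matrix $A$ is a matrix $R=PA$ with $P$ invertible which is in row echelon form; its pivot columns are the columns in which the first non-zero entry of some row of $R$ appears. Then $\Pi_\rho U$ has a row echelon form, and for every row echelon form $R$ of $\Pi_\rho U$, with pivot columns $i_1<\dots<i_s$ (where $s$ is the number of non-zero rows of $R$), $$\lim_{\alpha\to0^+}f_{\alpha,\alpha}(\rho\|\sigma)=\sum_{j=1}^s\lambda_{i_j},$$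 and, if $\operatorname{Tr}\rho=1$, the sandwiched Rényi divergence satisfies $$\lim_{\alpha\to0^+}D_{\alpha,\alpha}(\rho\|\sigma)=-\log_2\sum_{j=1}^s\lambda_{i_j}.$$ These limits depend only on $\Pi_\rho$ and $\sigma$: if $\rho'$ is positive semidefinite with $\Pi_{\rho'}=\Pi_\rho$, then $\lim_{\alpha\to0^+}f_{\alpha,\alpha}(\rho'\|\sigma)=\lim_{\alpha\to0^+}f_{\alpha,\alpha}(\rho\|\sigma)$, and if moreover $\operatorname{Tr}\rho=\operatorname{Tr}\rho'=1$, then $\lim_{\alpha\to0^+}D_{\alpha,\alpha}(\rho'\|\sigma)=\lim_{\alpha\to0^+}D_{\alpha,\alpha}(\rho\|\sigma)$. -/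

import Mathlib

open Filter Topology
open scoped Matrix MatrixOrder ComplexOrder

noncomputable section

/-- The trace functional `f_{α,z}(ρ‖σ) = Tr (σ^{(1-α)/2z} ρ^{α/z} σ^{(1-α)/2z})^z`.
All powers are powers of positive semidefinite matrices in the sense of the functional calculus
(`CFC.rpow`), so the matrix whose trace is taken is positive semidefinite and its trace is real
(see `traceFunctional_coe`); `ρ` and `σ` are positive semidefinite and `α, z > 0` here. -/
def traceFunctional {d : ℕ} (α z : ℝ) (ρ σ : Matrix (Fin d) (Fin d) ℂ) : ℝ :=
  (Matrix.trace
    (CFC.rpow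
      (CFC.rpow σ ((1 - α) / (2 * z)) * CFC.rpow ρ (α / z) * CFC.rpow σ ((1 - α) / (2 * z)))
      z)).re

/-- Taking the real part in `traceFunctional` loses nothing. -/
theorem traceFunctional_coe {d : ℕ} (α z : ℝ) (ρ σ : Matrix (Fin d) (Fin d) ℂ) :
    (traceFunctional α z ρ σ : ℂ) =
      Matrix.trace
        (CFC.rpow
          (CFC.rpow σ ((1 - α) / (2 * z)) * CFC.rpow ρ (α / z) * CFC.rpow σ ((1 - α) / (2 * z)))
          z) := by
  have h := (Matrix.nonneg_iff_posSemidef.mp (CFC.rpow_nonneg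
    (a := CFC.rpow σ ((1 - α) / (2 * z)) * CFC.rpow ρ (α / z) * CFC.rpow σ ((1 - α) / (2 * z)))
    (y := z))).trace_nonneg
  exact Complex.ext rfl (Complex.le_def.mp h).2

/-- The `α`-`z`-relative Rényi entropy `D_{α,z}(ρ‖σ) = (α - 1)⁻¹ log₂ f_{α,z}(ρ‖σ)` of a density
matrix `ρ` with respect to `σ`. For `z = α` it is the sandwiched Rényi divergence. -/
def renyiEntropy {d : ℕ} (α z : ℝ) (ρ σ : Matrix (Fin d) (Fin d) ℂ) : ℝ :=
  1 / (α - 1) * Real.logb 2 (traceFunctional α z ρ σ)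

/-- The matrix of the orthogonal projection of `ℂ^d` onto the support of `ρ`, which is the
orthogonal complement of the kernel of `ρ`. -/
def supportProj {d : ℕ} (ρ : Matrix (Fin d) (Fin d) ℂ) : Matrix (Fin d) (Fin d) ℂ :=
  Matrix.toEuclideanLin.symm
    ((LinearMap.ker (Matrix.toEuclideanLin ρ))ᗮ.starProjection :
      EuclideanSpace ℂ (Fin d) →ₗ[ℂ] EuclideanSpace ℂ (Fin d))

/-- `R` is a row echelon form of `A`: it is in row echelon form and is obtained from `A` by
invertible row operations. Changing the basis of the row space (replacing `A` by `V * A` with `V`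
invertible) does not change the row echelon forms of `A`. -/
def IsRowEchelonFormOf {d : ℕ} (R A : Matrix (Fin d) (Fin d) ℂ) : Prop :=
  R.IsRowEchelon ∧ ∃ P : Matrix (Fin d) (Fin d) ℂ, IsUnit P ∧ R = P * A

open Classical in
/-- The columns in which the first non-zero entry of some row of `R` appears. -/
def pivotColumns {d : ℕ} (R : Matrix (Fin d) (Fin d) ℂ) : Finset (Fin d) :=
  {j : Fin d | ∃ i : Fin d, R.IsLeadingEntry i j}

end

/-! Put `D = diag ev`, `B = Uᴴ * ρ * U` and `t = (1 - α) / (2 * α)`, which tends to infinity.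
Unitary invariance gives `f_{α,α} = Tr (D^t B D^t)^α`. Since `x ↦ x ^ α` is operator monotone for `0
< α ≤ 1` and `c ^ α → 1` for every `c > 0`, the limit does not change when `B` is replaced by a
positive semidefinite matrix with the same kernel: on positive semidefinite matrices, equal kernels
mean comparability up to constants (`exists_le_smul_of_ker_le`). The replacement is `Rᴴ * R`,
because `R` and `ρ * U` have the same kernel.

As `X * Xᴴ` and `Xᴴ * X` have the same characteristic polynomial, it remains to study `Tr (R D^(2t)
Rᴴ)^α`. Let `w i` be the value of `ev` at the pivot of row `i`. Entries left of the pivot vanish and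
`ev` is antitone, so after division of row `i` by `(w i)^t` the matrix `R D^t` converges, and its
limit still has independent non-zero rows (`posDef_rescaledLimit`). Hence `R D^(2t) Rᴴ` is
comparable to the diagonal matrix with entries `(w i)^(2t)` on the non-zero rows
(`exists_eventually_smul_diagonal_le`). Its `α`-th power has trace `∑ (w i)^(1-α)`, which tends to
the sum over the pivots, and a squeeze concludes. -/

/-! ### Existence of row echelon forms -/

section Echelon

variable {K : Type*} [Field K] {m n : ℕ}

open Classical in
/-- The number of zeros at the beginning of row `i` of `A`. -/
noncomputable def leadingZeros (A : Matrix (Fin m) (Fin n) K) (i : Fin m) : ℕ :=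
  Nat.find (p := fun k => ∀ h : k < n, A i ⟨k, h⟩ ≠ 0) ⟨n, fun h => absurd h (lt_irrefl n)⟩

theorem leadingZeros_le (A : Matrix (Fin m) (Fin n) K) (i : Fin m) : leadingZeros A i ≤ n := by
  classical
  exact Nat.find_min' _ fun h => absurd h (lt_irrefl n)

theorem apply_leadingZeros_ne_zero (A : Matrix (Fin m) (Fin n) K) (i : Fin m)
    (h : leadingZeros A i < n) : A i ⟨leadingZeros A i, h⟩ ≠ 0 := by
  classical
  exact Nat.find_spec (p := fun k => ∀ h : k < n, A i ⟨k, h⟩ ≠ 0)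
    ⟨n, fun h => absurd h (lt_irrefl n)⟩ h

theorem apply_eq_zero_of_lt_leadingZeros {A : Matrix (Fin m) (Fin n) K} {i : Fin m} {j : Fin n}
    (h : (j : ℕ) < leadingZeros A i) : A i j = 0 := by
  classical
  have := Nat.find_min (p := fun k => ∀ h : k < n, A i ⟨k, h⟩ ≠ 0)
    ⟨n, fun h => absurd h (lt_irrefl n)⟩ h
  push Not at this
  exact this.2

theorem le_leadingZeros {A : Matrix (Fin m) (Fin n) K} {i : Fin m} {k : ℕ} (hk : k ≤ n)
    (h : ∀ j : Fin n, (j : ℕ) < k → A i j = 0) : k ≤ leadingZeros A i := by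
  by_contra! hlt
  exact apply_leadingZeros_ne_zero A i (hlt.trans_le hk) (h _ hlt)

theorem leadingZeros_congr {A B : Matrix (Fin m) (Fin n) K} {i i' : Fin m} (h : ∀ j, A i j = B i' j) :
    leadingZeros A i = leadingZeros B i' := by
  apply le_antisymm
  · exact le_leadingZeros (leadingZeros_le A i) fun j hj =>
      (h j).symm.trans (apply_eq_zero_of_lt_leadingZeros hj)
  · exact le_leadingZeros (leadingZeros_le B i') fun j hj =>
      (h j).trans (apply_eq_zero_of_lt_leadingZeros hj)

/-- Sorting the rows by their number of leading zeros gives a row echelon form, provided that the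
leading entries of different non-zero rows are in different columns. -/
theorem isRowEchelon_of_monotone_leadingZeros {A : Matrix (Fin m) (Fin n) K}
    (hmono : Monotone (leadingZeros A))
    (hinj : ∀ i i', i ≠ i' → leadingZeros A i = leadingZeros A i' → leadingZeros A i = n) :
    A.IsRowEchelon := by
  intro i₁ i₂ hlt j hj
  apply apply_eq_zero_of_lt_leadingZeros
  have h₁ : (j : ℕ) ≤ leadingZeros A i₁ := le_leadingZeros j.2.le fun j' h => hj j' h
  rcases (hmono hlt.le).eq_or_lt with h | h
  · rw [← h, hinj i₁ i₂ hlt.ne h]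
    exact j.2
  · exact h₁.trans_lt h

/-- If two rows have their leading entries in the same column, then a row operation increases the
total number of leading zeros. -/
theorem exists_sum_leadingZeros_lt {A : Matrix (Fin m) (Fin n) K} {i i' : Fin m} (hne : i ≠ i')
    (heq : leadingZeros A i = leadingZeros A i') (hlt : leadingZeros A i < n) :
    ∃ T : Matrix (Fin m) (Fin m) K, IsUnit T ∧
      ∑ k, leadingZeros A k < ∑ k, leadingZeros (T * A) k := by
  set p : Fin n := ⟨leadingZeros A i, hlt⟩ with hp
  have hpiv : A i' p ≠ 0 := by
    have := apply_leadingZeros_ne_zero A i' (heq ▸ hlt)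
    simpa only [hp, heq] using this
  -- The coefficient cancels the entry of row `i` in column `p`. Both rows vanish before `p`, so row
  -- `i` gains a leading zero and the other rows stay the same.
  refine ⟨Matrix.transvection i i' (-(A i p / A i' p)), ?_, ?_⟩
  · rw [Matrix.isUnit_iff_isUnit_det, Matrix.det_transvection_of_ne _ _ hne]
    exact isUnit_one
  · have hi : leadingZeros A i <
        leadingZeros (Matrix.transvection i i' (-(A i p / A i' p)) * A) i := by
      apply le_leadingZeros hlt
      intro j hj
      rw [Matrix.transvection_mul_apply_same]
      rcases (Nat.lt_succ_iff.mp hj).eq_or_lt with h | h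
      · have : j = p := Fin.ext h
        subst this
        field_simp
        ring
      · have h0 : A i j = 0 := apply_eq_zero_of_lt_leadingZeros h
        have h1 : A i' j = 0 := apply_eq_zero_of_lt_leadingZeros (heq ▸ h)
        simp [h0, h1]
    refine Finset.sum_lt_sum (fun k _ => ?_) ⟨i, Finset.mem_univ _, hi⟩
    by_cases hk : k = i
    · subst hk; exact hi.le
    · refine (leadingZeros_congr fun j => ?_).le
      rw [Matrix.transvection_mul_apply_of_ne _ _ _ _ hk]

/-- The total number of leading zeros is bounded over all invertible `P`. At a maximum no two
non-zero rows share a leading column, and sorting the rows then suffices. -/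
theorem exists_isUnit_isRowEchelon_mul (A : Matrix (Fin m) (Fin n) K) :
    ∃ P : Matrix (Fin m) (Fin m) K, IsUnit P ∧ (P * A).IsRowEchelon := by
  set S : Set ℕ := {N | ∃ P : Matrix (Fin m) (Fin m) K, IsUnit P ∧
    N = ∑ k, leadingZeros (P * A) k} with hS
  have hne : S.Nonempty := ⟨_, 1, isUnit_one, rfl⟩
  have hbdd : BddAbove S := by
    refine ⟨∑ _k : Fin m, n, ?_⟩
    rintro _ ⟨P, -, rfl⟩
    exact Finset.sum_le_sum fun k _ => leadingZeros_le _ _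
  obtain ⟨P, hP, hPs⟩ := Nat.sSup_mem hne hbdd
  have hinj : ∀ i i', i ≠ i' → leadingZeros (P * A) i = leadingZeros (P * A) i' →
      leadingZeros (P * A) i = n := by
    intro i i' hii heq
    by_contra h
    obtain ⟨T, hT, hlt⟩ :=
      exists_sum_leadingZeros_lt hii heq (lt_of_le_of_ne (leadingZeros_le _ _) h)
    rw [← hPs, ← Matrix.mul_assoc] at hlt
    exact hlt.not_ge (le_csSup hbdd ⟨T * P, hT.mul hP, rfl⟩)
  set s := Tuple.sort (leadingZeros (P * A)) with hs
  have hrow : ∀ i, leadingZeros (P.submatrix s id * A) i = leadingZeros (P * A) (s i) :=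
    fun i => leadingZeros_congr fun _ => rfl
  refine ⟨P.submatrix s id, (Matrix.isUnit_submatrix_equiv s (Equiv.refl _)).2 hP,
    isRowEchelon_of_monotone_leadingZeros ?_ ?_⟩
  · intro i i' h
    rw [hrow, hrow]
    exact Tuple.monotone_sort (leadingZeros (P * A)) h
  · intro i i' h heq
    rw [hrow] at heq ⊢
    rw [hrow] at heq
    exact hinj _ _ (s.injective.ne h) heq

end Echelon

theorem exists_isRowEchelonFormOf {d : ℕ} (A : Matrix (Fin d) (Fin d) ℂ) :
    ∃ R, IsRowEchelonFormOf R A := by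
  obtain ⟨P, hP, hR⟩ := exists_isUnit_isRowEchelon_mul A
  exact ⟨P * A, hR, P, hP, rfl⟩

/-! ### Traces of powers of positive semidefinite matrices -/

section PowTrace

variable {d : ℕ}

/-- The trace of the power `A ^ p` of a positive semidefinite matrix. -/
noncomputable def powTrace (p : ℝ) (A : Matrix (Fin d) (Fin d) ℂ) : ℝ :=
  (Matrix.trace (CFC.rpow A p)).re

theorem sum_map_map_univ (w : Fin d → ℂ) (f : ℂ → ℝ) :
    ((Finset.univ.val.map w).map f).sum = ∑ i, f (w i) := by
  rw [Multiset.map_map]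
  rfl

/-- Expressing the trace through the characteristic polynomial makes unitary conjugation and the
exchange of `X * Xᴴ` with `Xᴴ * X` immediate. -/
theorem powTrace_eq_sum_roots {A : Matrix (Fin d) (Fin d) ℂ} (hA : 0 ≤ A) (p : ℝ) :
    powTrace p A = (A.charpoly.roots.map fun z => z.re ^ p).sum := by
  have hH : A.IsHermitian := (Matrix.nonneg_iff_posSemidef.1 hA).isHermitian
  rw [hH.roots_charpoly_eq_eigenvalues, powTrace, CFC.rpow_eq_pow, CFC.rpow_eq_cfc_real hA,
    hH.cfc_eq, Matrix.IsHermitian.cfc, Unitary.conjStarAlgAut_apply, Matrix.trace_mul_cycle,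
    sum_map_map_univ]
  simp [Matrix.trace_diagonal]

theorem roots_prod_univ_X_sub_C (w : Fin d → ℂ) :
    (∏ i, (Polynomial.X - Polynomial.C (w i))).roots = Finset.univ.val.map w := by
  rw [← Polynomial.roots_multiset_prod_X_sub_C (Finset.univ.val.map w), Multiset.map_map]
  rfl

theorem powTrace_congr_charpoly {A B : Matrix (Fin d) (Fin d) ℂ} (hA : 0 ≤ A) (hB : 0 ≤ B)
    (h : A.charpoly = B.charpoly) (p : ℝ) : powTrace p A = powTrace p B := by
  rw [powTrace_eq_sum_roots hA, powTrace_eq_sum_roots hB, h]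

theorem diagonal_ofReal_nonneg {w : Fin d → ℝ} (hw : ∀ i, 0 ≤ w i) :
    (0 : Matrix (Fin d) (Fin d) ℂ) ≤ Matrix.diagonal fun i => (w i : ℂ) := by
  rw [Matrix.nonneg_iff_posSemidef, Matrix.posSemidef_diagonal_iff]
  exact fun i => by exact_mod_cast hw i

theorem powTrace_diagonal {w : Fin d → ℝ} (hw : ∀ i, 0 ≤ w i) (p : ℝ) :
    powTrace p (Matrix.diagonal fun i => (w i : ℂ)) = ∑ i, w i ^ p := by
  have h0 := diagonal_ofReal_nonneg hw
  rw [powTrace_eq_sum_roots h0, Matrix.charpoly_diagonal, roots_prod_univ_X_sub_C,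
    sum_map_map_univ]
  simp

-- Löwner–Heinz: this is what restricts the exponent to `[0, 1]`.
open scoped Matrix.Norms.L2Operator in
theorem powTrace_mono {A B : Matrix (Fin d) (Fin d) ℂ} {p : ℝ} (hp : p ∈ Set.Icc (0 : ℝ) 1)
    (h : A ≤ B) : powTrace p A ≤ powTrace p B := by
  have h1 : CFC.rpow A p ≤ CFC.rpow B p := CFC.rpow_le_rpow hp h
  have h2 := (Matrix.le_iff.1 h1).trace_nonneg
  rw [Matrix.trace_sub] at h2
  have := (Complex.le_def.1 h2).1
  simpa [powTrace] using this

theorem powTrace_smul {A : Matrix (Fin d) (Fin d) ℂ} (hA : 0 ≤ A) {c : ℝ} (hc : 0 ≤ c) (p : ℝ) :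
    powTrace p (c • A) = c ^ p * powTrace p A := by
  have hH : A.IsHermitian := (Matrix.nonneg_iff_posSemidef.1 hA).isHermitian
  have hev := (Matrix.nonneg_iff_posSemidef.1 hA).eigenvalues_nonneg
  have h1 : (c • A) = cfc (fun x : ℝ => c * x) A := by
    rw [cfc_const_mul_id c A]
  have hcA : 0 ≤ c • A := smul_nonneg hc hA
  rw [powTrace_eq_sum_roots hcA, powTrace_eq_sum_roots hA, h1, hH.charpoly_cfc_eq,
    roots_prod_univ_X_sub_C, hH.roots_charpoly_eq_eigenvalues,
    sum_map_map_univ, sum_map_map_univ]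
  simp [Finset.mul_sum, Real.mul_rpow hc (hev _)]

theorem aeval_conj_diagonal {U : Matrix (Fin d) (Fin d) ℂ}
    (hU : U ∈ Matrix.unitaryGroup (Fin d) ℂ) (w : Fin d → ℝ) (q : Polynomial ℝ) :
    Polynomial.aeval (U * Matrix.diagonal (fun i => (w i : ℂ)) * Uᴴ) q =
      U * Matrix.diagonal (fun i => ((q.eval (w i) : ℝ) : ℂ)) * Uᴴ := by
  have h1 : U * Uᴴ = 1 := Matrix.mem_unitaryGroup_iff.1 hU
  have h2 : Uᴴ * U = 1 := Matrix.mem_unitaryGroup_iff'.1 hU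
  induction q using Polynomial.induction_on with
  | C a =>
    have : (Matrix.diagonal fun _ : Fin d => (a : ℂ)) = a • (1 : Matrix (Fin d) (Fin d) ℂ) := by
      ext i j
      by_cases h : i = j <;> simp [h]
    simp only [Polynomial.aeval_C, Polynomial.eval_C, this, Algebra.algebraMap_eq_smul_one]
    rw [Matrix.mul_smul, Matrix.smul_mul, Matrix.mul_one, h1]
  | add p q hp hq =>
    rw [map_add, hp, hq, ← Matrix.add_mul, ← Matrix.mul_add, Matrix.diagonal_add]
    simp
  | monomial n a h =>
    rw [pow_succ, ← mul_assoc, map_mul, h, Polynomial.aeval_X]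
    have (X Y : Matrix (Fin d) (Fin d) ℂ) : U * X * Uᴴ * (U * Y * Uᴴ) = U * (X * Y) * Uᴴ := by
      calc U * X * Uᴴ * (U * Y * Uᴴ) = U * X * (Uᴴ * U) * Y * Uᴴ := by
            simp only [Matrix.mul_assoc]
        _ = _ := by rw [h2, Matrix.mul_one]; simp only [Matrix.mul_assoc]
    rw [this, Matrix.diagonal_mul_diagonal]
    simp

theorem posSemidef_conj_diagonal (U : Matrix (Fin d) (Fin d) ℂ) {w : Fin d → ℝ}
    (hw : ∀ i, 0 ≤ w i) : 0 ≤ U * Matrix.diagonal (fun i => (w i : ℂ)) * Uᴴ := by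
  have h0 := diagonal_ofReal_nonneg hw
  exact star_right_conjugate_nonneg h0 U

/-- Real powers of a diagonalized positive semidefinite matrix. -/
theorem rpow_conj_diagonal {U : Matrix (Fin d) (Fin d) ℂ}
    (hU : U ∈ Matrix.unitaryGroup (Fin d) ℂ) {w : Fin d → ℝ} (hw : ∀ i, 0 ≤ w i) (t : ℝ) :
    CFC.rpow (U * Matrix.diagonal (fun i => (w i : ℂ)) * Uᴴ) t =
      U * Matrix.diagonal (fun i => ((w i ^ t : ℝ) : ℂ)) * Uᴴ := by
  have hA := posSemidef_conj_diagonal U hw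
  set A := U * Matrix.diagonal (fun i => (w i : ℂ)) * Uᴴ with hAdef
  -- The spectrum consists of values of `w`, so an interpolating polynomial replaces `x ↦ x ^ t` in
  -- the functional calculus.
  obtain ⟨q, hq⟩ : ∃ q : Polynomial ℝ, ∀ x ∈ Finset.univ.image w, q.eval x = x ^ t :=
    ⟨Lagrange.interpolate (Finset.univ.image w) id (fun x => x ^ t), fun x hx => by
      simpa using Lagrange.eval_interpolate_at_node (fun x : ℝ => x ^ t)
        (s := Finset.univ.image w) (v := id) Function.injective_id.injOn hx⟩
  have hspec : ∀ x ∈ spectrum ℝ A, x ∈ Finset.univ.image w := by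
    intro x hx
    have h := spectrum.algebraMap_mem ℂ hx
    have hconj : spectrum ℂ A = spectrum ℂ (Matrix.diagonal fun i => (w i : ℂ)) :=
      Unitary.spectrum_star_right_conjugate (U := ⟨U, hU⟩)
    rw [hconj, spectrum_diagonal] at h
    obtain ⟨i, hi⟩ := h
    simp only [Finset.mem_image, Finset.mem_univ, true_and]
    exact ⟨i, by simpa using hi⟩
  rw [CFC.rpow_eq_pow, CFC.rpow_eq_cfc_real hA,
    cfc_congr (fun x hx => (hq x (hspec x hx)).symm), cfc_polynomial q A, hAdef,
    aeval_conj_diagonal hU]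
  simp_rw [fun i => hq (w i) (Finset.mem_image_of_mem w (Finset.mem_univ i))]

end PowTrace

/-! ### Comparison of positive semidefinite matrices -/

section Comparison

variable {d : ℕ}

theorem diagonal_ofReal_mono {v w : Fin d → ℝ} (h : ∀ i, v i ≤ w i) :
    (Matrix.diagonal fun i => (v i : ℂ)) ≤ Matrix.diagonal fun i => (w i : ℂ) := by
  have := diagonal_ofReal_nonneg fun i => sub_nonneg.2 (h i)
  rw [← sub_nonneg, Matrix.diagonal_sub]
  simpa using this

open scoped Matrix.Norms.L2Operator in
theorem exists_le_smul_one {A : Matrix (Fin d) (Fin d) ℂ} (hA : A.IsHermitian) :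
    ∃ C : ℝ, 0 < C ∧ A ≤ C • (1 : Matrix (Fin d) (Fin d) ℂ) := by
  refine ⟨‖A‖ + 1, by positivity, ?_⟩
  have h1 : A ≤ algebraMap ℝ _ ‖A‖ := IsSelfAdjoint.le_algebraMap_norm_self hA
  rw [Algebra.algebraMap_eq_smul_one] at h1
  refine h1.trans (smul_le_smul_of_nonneg_right (by linarith) zero_le_one)

/-- A positive semidefinite matrix which vanishes on the kernel of another one is bounded by a
multiple of it. -/
theorem exists_le_smul_of_ker_le {A B : Matrix (Fin d) (Fin d) ℂ} (hA : 0 ≤ A) (hB : 0 ≤ B)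
    (hker : ∀ M : Matrix (Fin d) (Fin d) ℂ, A * M = 0 → B * M = 0) :
    ∃ C : ℝ, 0 < C ∧ B ≤ C • A := by
  have hH : A.IsHermitian := (Matrix.nonneg_iff_posSemidef.1 hA).isHermitian
  have hBH : B.IsHermitian := (Matrix.nonneg_iff_posSemidef.1 hB).isHermitian
  have hev := (Matrix.nonneg_iff_posSemidef.1 hA).eigenvalues_nonneg
  set e := hH.eigenvalues with he
  set V : Matrix (Fin d) (Fin d) ℂ := hH.eigenvectorUnitary.1 with hV
  have hVV : V * Vᴴ = 1 := Matrix.mem_unitaryGroup_iff.1 hH.eigenvectorUnitary.2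
  have hVV' : Vᴴ * V = 1 := Matrix.mem_unitaryGroup_iff'.1 hH.eigenvectorUnitary.2
  set E : Matrix (Fin d) (Fin d) ℂ := Matrix.diagonal fun i => (e i : ℂ) with hE
  have hspec : A = V * E * Vᴴ := by
    conv_lhs => rw [hH.spectral_theorem, Unitary.conjStarAlgAut_apply]
    rfl
  -- In the eigenbasis of `A`, the matrix `S` is the projection onto the support of `A`; `B'`, which
  -- is `B` in that basis, lives on it.
  let s : Fin d → ℝ := fun i => if e i = 0 then 0 else 1
  set S : Matrix (Fin d) (Fin d) ℂ := Matrix.diagonal fun i => (s i : ℂ) with hS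
  have hES : E * (1 - S) = 0 := by
    rw [Matrix.mul_sub, Matrix.mul_one, hE, hS, Matrix.diagonal_mul_diagonal, sub_eq_zero]
    congr 1
    funext i
    by_cases h : e i = 0 <;> simp [s, h]
  have hBS : B * (V * (1 - S)) = 0 := by
    apply hker
    rw [hspec]
    calc V * E * Vᴴ * (V * (1 - S)) = V * E * (Vᴴ * V) * (1 - S) := by
          simp only [Matrix.mul_assoc]
      _ = 0 := by rw [hVV', Matrix.mul_one, Matrix.mul_assoc, hES, Matrix.mul_zero]
  have hSstar : Sᴴ = S := by
    rw [hS, Matrix.diagonal_conjTranspose]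
    congr 1
    funext i
    simp
  have hSS : S * S = S := by
    rw [hS, Matrix.diagonal_mul_diagonal]
    congr 1
    funext i
    by_cases h : e i = 0 <;> simp [s, h]
  set B' := Vᴴ * B * V with hB'
  have h1 : B' * S = B' := by
    have : B' * (1 - S) = 0 := by
      rw [hB', Matrix.mul_assoc, Matrix.mul_assoc, hBS, Matrix.mul_zero]
    rw [Matrix.mul_sub, Matrix.mul_one, sub_eq_zero] at this
    exact this.symm
  have hB'H : B'.IsHermitian := Matrix.isHermitian_conjTranspose_mul_mul V hBH
  have h2 : S * B' = B' := by
    have := congrArg Matrix.conjTranspose h1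
    rwa [Matrix.conjTranspose_mul, hSstar, hB'H.eq] at this
  obtain ⟨C, hC, hBC⟩ := exists_le_smul_one hB'H
  have h3 : B' ≤ C • S := by
    have := star_right_conjugate_le_conjugate hBC S
    rw [Matrix.star_eq_conjTranspose, hSstar, h2, h1, Matrix.mul_smul, Matrix.smul_mul,
      Matrix.mul_one, hSS] at this
    exact this
  have hk : ∀ i, 0 ≤ (e i)⁻¹ := fun i => inv_nonneg.2 (hev i)
  -- Any positive bound for the inverses of the non-zero eigenvalues works. Zero eigenvalues
  -- contribute `0⁻¹ = 0`, and the summand `1` keeps `k` positive.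
  set k : ℝ := 1 + ∑ i, (e i)⁻¹ with hkdef
  have hkpos : 0 < k := add_pos_of_pos_of_nonneg one_pos (Finset.sum_nonneg fun i _ => hk i)
  have h4 : S ≤ k • E := by
    have : k • E = Matrix.diagonal fun i => ((k * e i : ℝ) : ℂ) := by
      rw [hE, ← Matrix.diagonal_smul]
      congr 1
      funext i
      simp
    rw [this]
    refine diagonal_ofReal_mono fun i => ?_
    by_cases h : e i = 0
    · simp [s, h]
    · have h5 : (e i)⁻¹ ≤ k := by
        have := Finset.single_le_sum (fun i _ => hk i) (Finset.mem_univ i)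
        linarith
      have h6 := mul_le_mul_of_nonneg_right h5 (hev i)
      rw [inv_mul_cancel₀ h] at h6
      simpa [s, h] using h6
  refine ⟨C * k, mul_pos hC hkpos, ?_⟩
  have h7 : B' ≤ (C * k) • E := by
    rw [mul_smul]
    exact h3.trans (smul_le_smul_of_nonneg_left h4 hC.le)
  have h8 := star_right_conjugate_le_conjugate h7 V
  rw [Matrix.star_eq_conjTranspose, Matrix.mul_smul, Matrix.smul_mul, ← hspec] at h8
  refine le_of_eq_of_le ?_ h8
  calc B = (V * Vᴴ) * B * (V * Vᴴ) := by rw [hVV, Matrix.one_mul, Matrix.mul_one]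
    _ = _ := by simp only [hB', Matrix.mul_assoc]

open scoped Matrix.Norms.L2Operator in
/-- Hermitian matrices converging to a positive definite one are eventually bounded, and bounded
away from zero. -/
theorem exists_eventually_smul_one_le {ι : Type*} {l : Filter ι}
    {K : ι → Matrix (Fin d) (Fin d) ℂ} {K₀ : Matrix (Fin d) (Fin d) ℂ}
    (hK : ∀ t, (K t).IsHermitian) (hlim : Tendsto K l (𝓝 K₀)) (hpos : K₀.PosDef) :
    ∃ c C : ℝ, 0 < c ∧ 0 < C ∧ ∀ᶠ t in l, c • (1 : Matrix (Fin d) (Fin d) ℂ) ≤ K t ∧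
      K t ≤ C • (1 : Matrix (Fin d) (Fin d) ℂ) := by
  obtain ⟨k, hk, hle⟩ := exists_le_smul_of_ker_le (A := K₀) (B := 1)
    (Matrix.nonneg_iff_posSemidef.2 hpos.posSemidef) zero_le_one fun M hM => by
      have := congrArg (K₀⁻¹ * ·) hM
      simpa [← Matrix.mul_assoc, Matrix.nonsing_inv_mul _ ((Matrix.isUnit_iff_isUnit_det _).1
        hpos.isUnit)] using this
  obtain ⟨C, hC, hleC⟩ := exists_le_smul_one hpos.isHermitian
  have hle' : k⁻¹ • (1 : Matrix (Fin d) (Fin d) ℂ) ≤ K₀ := by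
    have := smul_le_smul_of_nonneg_left hle (inv_nonneg.2 hk.le)
    rwa [smul_smul, inv_mul_cancel₀ hk.ne', one_smul] at this
  -- Since `k⁻¹ ≤ K₀ ≤ C`, a perturbation of norm below `k⁻¹ / 2` leaves half of the lower bound.
  refine ⟨k⁻¹ / 2, C + k⁻¹ / 2, by positivity, by positivity, ?_⟩
  have hev : ∀ᶠ t in l, ‖K t - K₀‖ < k⁻¹ / 2 := by
    have := (tendsto_iff_norm_sub_tendsto_zero.1 hlim)
    exact this.eventually_lt_const (by positivity)
  filter_upwards [hev] with t ht
  have hsa : IsSelfAdjoint (K t - K₀) := (hK t).sub hpos.isHermitian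
  have h1 : K t - K₀ ≤ algebraMap ℝ _ ‖K t - K₀‖ := IsSelfAdjoint.le_algebraMap_norm_self hsa
  have h2 : -algebraMap ℝ _ ‖K t - K₀‖ ≤ K t - K₀ :=
    IsSelfAdjoint.neg_algebraMap_norm_le_self hsa
  rw [Algebra.algebraMap_eq_smul_one] at h1 h2
  have h3 : ‖K t - K₀‖ • (1 : Matrix (Fin d) (Fin d) ℂ) ≤ (k⁻¹ / 2) • 1 :=
    smul_le_smul_of_nonneg_right ht.le zero_le_one
  constructor
  · have h4 := add_le_add hle' ((neg_le_neg h3).trans h2)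
    rw [add_sub_cancel, ← sub_eq_add_neg, ← sub_smul, sub_half] at h4
    exact h4
  · have h4 := add_le_add hleC (h1.trans h3)
    rw [add_sub_cancel, ← add_smul] at h4
    exact h4

end Comparison

/-- The projection onto `(ker ρ)ᗮ` has kernel `ker ρ`; apply this to each column of `M`. -/
theorem supportProj_mul_eq_zero_iff {d : ℕ} (ρ M : Matrix (Fin d) (Fin d) ℂ) :
    supportProj ρ * M = 0 ↔ ρ * M = 0 := by
  have key (x : EuclideanSpace ℂ (Fin d)) :
      Matrix.toEuclideanLin (supportProj ρ) x = 0 ↔ Matrix.toEuclideanLin ρ x = 0 := by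
    rw [supportProj, LinearEquiv.apply_symm_apply]
    change (LinearMap.ker (Matrix.toEuclideanLin ρ))ᗮ.starProjection x = 0 ↔ _
    rw [Submodule.starProjection_apply_eq_zero_iff, Submodule.orthogonal_orthogonal,
      LinearMap.mem_ker]
  have hcol (A : Matrix (Fin d) (Fin d) ℂ) :
      A * M = 0 ↔ ∀ j, Matrix.toEuclideanLin A (WithLp.toLp 2 (M.col j)) = 0 := by
    constructor
    · intro h j
      ext i
      exact congrFun (congrFun h i) j
    · intro h
      ext i j
      exact congrArg (fun v : EuclideanSpace ℂ (Fin d) => v i) (h j)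
  rw [hcol, hcol]
  exact forall_congr' fun j => key _

/-! ### Rescaled row echelon forms -/

section Rescaling

variable {d : ℕ}

open Classical in
/-- The weight `ev c` of the leading entry `c` of row `i`, and `1` for a zero row. -/
noncomputable def rowWeight (R : Matrix (Fin d) (Fin d) ℂ) (ev : Fin d → ℝ) (i : Fin d) : ℝ :=
  if h : ∃ c, R.IsLeadingEntry i c then ev h.choose else 1

theorem rowWeight_eq {R : Matrix (Fin d) (Fin d) ℂ} (ev : Fin d → ℝ) {i c : Fin d}
    (h : R.IsLeadingEntry i c) : rowWeight R ev i = ev c := by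
  have hex : ∃ c, R.IsLeadingEntry i c := ⟨c, h⟩
  rw [rowWeight, dif_pos hex, hex.choose_spec.unique h]

theorem rowWeight_pos (R : Matrix (Fin d) (Fin d) ℂ) {ev : Fin d → ℝ} (hev : ∀ i, 0 < ev i)
    (i : Fin d) : 0 < rowWeight R ev i := by
  rw [rowWeight]
  split_ifs
  · exact hev _
  · exact one_pos

theorem apply_eq_zero_of_not_exists_isLeadingEntry {R : Matrix (Fin d) (Fin d) ℂ} {i : Fin d}
    (h : ¬∃ c, R.IsLeadingEntry i c) (j : Fin d) : R i j = 0 := by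
  rw [← Matrix.row_ne_zero_iff_exists_isLeadingEntry, not_not] at h
  exact congrFun h j

theorem isLeadingEntry_injective {R : Matrix (Fin d) (Fin d) ℂ} (hR : R.IsRowEchelon)
    {i i' c : Fin d} (h : R.IsLeadingEntry i c) (h' : R.IsLeadingEntry i' c) : i = i' := by
  rcases lt_trichotomy i i' with hlt | heq | hlt
  · exact absurd (hR hlt h.1) h'.2
  · exact heq
  · exact absurd (hR hlt h'.1) h.2

open Classical in
theorem sum_rowWeight {R : Matrix (Fin d) (Fin d) ℂ} (hR : R.IsRowEchelon) (ev : Fin d → ℝ) :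
    ∑ i, (if ∃ c, R.IsLeadingEntry i c then rowWeight R ev i else 0) =
      ∑ j ∈ pivotColumns R, ev j := by
  rw [← Finset.sum_filter]
  refine Finset.sum_bij (fun i hi => (Finset.mem_filter.1 hi).2.choose) ?_ ?_ ?_ ?_
  · intro i hi
    simp only [pivotColumns, Finset.mem_filter, Finset.mem_univ, true_and]
    exact ⟨i, (Finset.mem_filter.1 hi).2.choose_spec⟩
  · intro i hi i' hi' h
    have h1 := (Finset.mem_filter.1 hi).2.choose_spec
    have h2 := (Finset.mem_filter.1 hi').2.choose_spec
    rw [← h] at h2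
    exact isLeadingEntry_injective hR h1 h2
  · intro j hj
    simp only [pivotColumns, Finset.mem_filter, Finset.mem_univ, true_and] at hj
    obtain ⟨i, hi⟩ := hj
    have hex : ∃ c, R.IsLeadingEntry i c := ⟨j, hi⟩
    exact ⟨i, Finset.mem_filter.2 ⟨Finset.mem_univ _, hex⟩, hex.choose_spec.unique hi⟩
  · intro i hi
    exact rowWeight_eq ev (Finset.mem_filter.1 hi).2.choose_spec

/-- The entries of `R` after division of the rows by powers of their weights. -/
noncomputable def rescaled (R : Matrix (Fin d) (Fin d) ℂ) (ev : Fin d → ℝ) (t : ℝ) :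
    Matrix (Fin d) (Fin d) ℂ :=
  fun i j => R i j * (((ev j / rowWeight R ev i) ^ t : ℝ) : ℂ)

/-- The limit of the matrices `rescaled R ev t` for `t → ∞`. -/
noncomputable def rescaledLimit (R : Matrix (Fin d) (Fin d) ℂ) (ev : Fin d → ℝ) :
    Matrix (Fin d) (Fin d) ℂ :=
  fun i j => if ev j = rowWeight R ev i then R i j else 0

/-- Where `R i j ≠ 0`, column `j` is not left of the pivot, so the ratio of weights is at most `1`
and its powers are constant or tend to `0`. -/
theorem tendsto_rescaled (R : Matrix (Fin d) (Fin d) ℂ) {ev : Fin d → ℝ}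
    (hpos : ∀ i, 0 < ev i) (hev : Antitone ev) :
    Tendsto (rescaled R ev) atTop (𝓝 (rescaledLimit R ev)) := by
  refine tendsto_pi_nhds.2 fun i => tendsto_pi_nhds.2 fun j => ?_
  simp only [rescaled, rescaledLimit]
  by_cases h0 : R i j = 0
  · simp [h0]
  have hw := rowWeight_pos R hpos i
  split_ifs with h
  · simp [h, div_self hw.ne']
  · have hex : ∃ c, R.IsLeadingEntry i c := by
      by_contra hne
      exact h0 (apply_eq_zero_of_not_exists_isLeadingEntry hne j)
    obtain ⟨c, hc⟩ := hex
    have hle : ev j ≤ rowWeight R ev i := by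
      rw [rowWeight_eq ev hc]
      exact hev (not_lt.1 fun hlt => h0 (hc.1 j hlt))
    have hlt := lt_of_le_of_ne hle h
    have h1 : Tendsto (fun t : ℝ => (ev j / rowWeight R ev i) ^ t) atTop (𝓝 0) :=
      tendsto_rpow_atTop_of_base_lt_one _
        (lt_of_lt_of_le (by norm_num) (div_pos (hpos j) hw).le) ((div_lt_one hw).2 hlt)
    have h2 := ((Complex.continuous_ofReal.tendsto 0).comp h1).const_mul (R i j)
    simpa using h2

open Classical in
/-- The projection onto the coordinates of the non-zero rows of `R`. -/
noncomputable def rowProj (R : Matrix (Fin d) (Fin d) ℂ) : Matrix (Fin d) (Fin d) ℂ :=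
  Matrix.diagonal fun i => ((if ∃ c, R.IsLeadingEntry i c then 1 else 0 : ℝ) : ℂ)

open Classical in
theorem one_sub_rowProj (R : Matrix (Fin d) (Fin d) ℂ) :
    1 - rowProj R =
      Matrix.diagonal fun i => ((if ∃ c, R.IsLeadingEntry i c then 0 else 1 : ℝ) : ℂ) := by
  rw [rowProj, ← Matrix.diagonal_one, Matrix.diagonal_sub]
  congr 1
  funext i
  split_ifs <;> simp

theorem one_sub_rowProj_posSemidef (R : Matrix (Fin d) (Fin d) ℂ) :
    (1 - rowProj R).PosSemidef := by
  classical
  rw [one_sub_rowProj, ← Matrix.nonneg_iff_posSemidef]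
  refine diagonal_ofReal_nonneg fun i => ?_
  split_ifs <;> norm_num

theorem posDef_rescaledLimit {R : Matrix (Fin d) (Fin d) ℂ} (hR : R.IsRowEchelon)
    (ev : Fin d → ℝ) :
    (rescaledLimit R ev * (rescaledLimit R ev)ᴴ + (1 - rowProj R)).PosDef := by
  classical
  set G := rescaledLimit R ev with hG
  have hG' : (G * Gᴴ).PosSemidef := Matrix.posSemidef_self_mul_conjTranspose G
  have hQ := one_sub_rowProj_posSemidef R
  refine Matrix.PosDef.of_dotProduct_mulVec_pos (hG'.add hQ).isHermitian fun x hx => ?_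
  refine lt_of_le_of_ne ((hG'.add hQ).dotProduct_mulVec_nonneg x) fun h0 => hx ?_
  rw [Matrix.add_mulVec, dotProduct_add] at h0
  obtain ⟨h1, h2⟩ := (add_eq_zero_iff_of_nonneg (hG'.dotProduct_mulVec_nonneg x)
    (hQ.dotProduct_mulVec_nonneg x)).1 h0.symm
  rw [hG'.dotProduct_mulVec_zero_iff, Matrix.self_mul_conjTranspose_mulVec_eq_zero] at h1
  rw [hQ.dotProduct_mulVec_zero_iff, one_sub_rowProj] at h2
  funext i
  -- In the pivot column of row `i`, lower rows vanish by the echelon form and the earlier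
  -- coordinates of `x` vanish by induction, so `Gᴴ x = 0` forces `x i = 0`. On zero rows the
  -- summand `1 - rowProj R` does this.
  induction i using WellFoundedLT.induction with
  | ind i ih =>
    by_cases hex : ∃ c, R.IsLeadingEntry i c
    · obtain ⟨c, hc⟩ := hex
      have h3 := congrFun h1 c
      simp only [Matrix.mulVec, dotProduct, Matrix.conjTranspose_apply, Pi.zero_apply] at h3
      rw [Finset.sum_eq_single i] at h3
      · have h4 : G i c = R i c := by simp [hG, rescaledLimit, rowWeight_eq ev hc]
        rw [h4] at h3
        exact (mul_eq_zero.1 h3).resolve_left (star_ne_zero.2 hc.2)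
      · intro k _ hk
        rcases hk.lt_or_gt with hlt | hlt
        · rw [ih k hlt]; simp
        · have h5 : R k c = 0 := hR hlt hc.1
          have h6 : G k c = 0 := by simp [hG, rescaledLimit, h5]
          rw [h6]; simp
      · exact fun h => absurd (Finset.mem_univ i) h
    · have h3 := congrFun h2 i
      rw [Matrix.mulVec_diagonal] at h3
      simpa [hex] using h3

open Classical in
/-- The matrix `R D ^ (2 t) Rᴴ`, where `D = diag ev`, is comparable to the diagonal matrix of the
powers of the weights of the rows of `R`. -/
theorem exists_eventually_smul_diagonal_le {R : Matrix (Fin d) (Fin d) ℂ} (hR : R.IsRowEchelon)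
    {ev : Fin d → ℝ} (hpos : ∀ i, 0 < ev i) (hev : Antitone ev) :
    ∃ c C : ℝ, 0 < c ∧ 0 < C ∧ ∀ᶠ t : ℝ in atTop,
      c • (Matrix.diagonal fun i =>
          (((if ∃ c, R.IsLeadingEntry i c then (rowWeight R ev i ^ t) ^ 2 else 0 : ℝ)) : ℂ)) ≤
        (R * Matrix.diagonal fun i => ((ev i ^ t : ℝ) : ℂ)) *
          (R * Matrix.diagonal fun i => ((ev i ^ t : ℝ) : ℂ))ᴴ ∧
      (R * Matrix.diagonal fun i => ((ev i ^ t : ℝ) : ℂ)) *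
          (R * Matrix.diagonal fun i => ((ev i ^ t : ℝ) : ℂ))ᴴ ≤
        C • (Matrix.diagonal fun i =>
          (((if ∃ c, R.IsLeadingEntry i c then (rowWeight R ev i ^ t) ^ 2 else 0 : ℝ)) : ℂ)) := by
  have hlim : Tendsto (fun t => rescaled R ev t * (rescaled R ev t)ᴴ + (1 - rowProj R)) atTop
      (𝓝 (rescaledLimit R ev * (rescaledLimit R ev)ᴴ + (1 - rowProj R))) := by
    have h := tendsto_rescaled R hpos hev
    have hcont : Continuous fun G : Matrix (Fin d) (Fin d) ℂ => G * Gᴴ + (1 - rowProj R) := by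
      fun_prop
    exact (hcont.tendsto _).comp h
  obtain ⟨c, C, hc, hC, hcC⟩ := exists_eventually_smul_one_le
    (fun t => ((Matrix.posSemidef_self_mul_conjTranspose _).add
      (one_sub_rowProj_posSemidef R)).isHermitian) hlim (posDef_rescaledLimit hR ev)
  refine ⟨c, C, hc, hC, ?_⟩
  filter_upwards [hcC] with t ht
  -- Conjugation by `W` undoes the rescaling and annihilates the auxiliary summand `1 - rowProj R`.
  set W : Matrix (Fin d) (Fin d) ℂ := Matrix.diagonal fun i =>
    ((if ∃ c, R.IsLeadingEntry i c then rowWeight R ev i ^ t else 0 : ℝ) : ℂ) with hW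
  have hWstar : Wᴴ = W := by
    rw [hW, Matrix.diagonal_conjTranspose]
    congr 1
    funext i
    simp only [Pi.star_apply]
    exact Complex.conj_ofReal _
  have hWW : W * W = Matrix.diagonal fun i =>
      (((if ∃ c, R.IsLeadingEntry i c then (rowWeight R ev i ^ t) ^ 2 else 0 : ℝ)) : ℂ) := by
    rw [hW, Matrix.diagonal_mul_diagonal]
    congr 1
    funext i
    split_ifs <;> simp [sq]
  have hWQ : W * (1 - rowProj R) = 0 := by
    rw [one_sub_rowProj, hW, Matrix.diagonal_mul_diagonal, ← Matrix.diagonal_zero]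
    congr 1
    funext i
    split_ifs <;> simp
  have hWG : W * rescaled R ev t = R * Matrix.diagonal fun i => ((ev i ^ t : ℝ) : ℂ) := by
    ext i j
    rw [hW, Matrix.diagonal_mul, Matrix.mul_diagonal]
    simp only [rescaled]
    split_ifs with h
    · have hw := rowWeight_pos R hpos i
      rw [Real.div_rpow (hpos j).le hw.le, mul_left_comm, ← Complex.ofReal_mul,
        mul_div_cancel₀ _ (Real.rpow_pos_of_pos hw t).ne']
    · rw [apply_eq_zero_of_not_exists_isLeadingEntry h j]; simp
  have hconj : W * (rescaled R ev t * (rescaled R ev t)ᴴ + (1 - rowProj R)) * W =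
      (R * Matrix.diagonal fun i => ((ev i ^ t : ℝ) : ℂ)) *
        (R * Matrix.diagonal fun i => ((ev i ^ t : ℝ) : ℂ))ᴴ := by
    rw [Matrix.mul_add, hWQ, add_zero, ← hWG, Matrix.conjTranspose_mul, hWstar]
    simp only [Matrix.mul_assoc]
  have h1 := star_right_conjugate_le_conjugate ht.1 W
  have h2 := star_right_conjugate_le_conjugate ht.2 W
  rw [Matrix.star_eq_conjTranspose, hWstar, hconj, Matrix.mul_smul, Matrix.smul_mul,
    Matrix.mul_one, hWW] at h1 h2
  exact ⟨h1, h2⟩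

end Rescaling

/-! ### The limit of the trace functional -/

section Limit

variable {d : ℕ}

theorem tendsto_one_sub_div_two_mul :
    Tendsto (fun α : ℝ => (1 - α) / (2 * α)) (𝓝[>] 0) atTop := by
  have h1 : Tendsto (fun α : ℝ => (1 - α) / 2) (𝓝[>] 0) (𝓝 ((1 - 0) / 2)) :=
    ((continuous_const.sub continuous_id).div_const 2).continuousAt.mono_left nhdsWithin_le_nhds
  have h2 := h1.pos_mul_atTop (by norm_num) tendsto_inv_nhdsGT_zero
  refine h2.congr fun α => ?_
  rw [div_mul_eq_div_div, div_eq_mul_inv ((1 - α) / 2)]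

theorem tendsto_const_rpow_nhdsGT_zero {c : ℝ} (hc : 0 < c) :
    Tendsto (fun α : ℝ => c ^ α) (𝓝[>] 0) (𝓝 1) := by
  have h : ContinuousAt (fun α : ℝ => c ^ α) 0 := Real.continuousAt_const_rpow hc.ne'
  have := h.tendsto.mono_left (nhdsWithin_le_nhds (s := Set.Ioi 0))
  rwa [Real.rpow_zero] at this

open Classical in
theorem tendsto_sum_rowWeight_rpow {R : Matrix (Fin d) (Fin d) ℂ} (hR : R.IsRowEchelon)
    {ev : Fin d → ℝ} (hpos : ∀ i, 0 < ev i) :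
    Tendsto (fun α : ℝ => ∑ i, (if ∃ c, R.IsLeadingEntry i c then
        (rowWeight R ev i ^ ((1 - α) / (2 * α))) ^ 2 else 0) ^ α) (𝓝[>] 0)
      (𝓝 (∑ j ∈ pivotColumns R, ev j)) := by
  rw [← sum_rowWeight hR ev]
  refine tendsto_finsetSum _ fun i _ => ?_
  split_ifs with h
  · have hw := rowWeight_pos R hpos i
    have hcont : ContinuousAt (fun α : ℝ => rowWeight R ev i ^ (1 - α)) 0 :=
      (Real.continuousAt_const_rpow hw.ne').comp (continuousAt_const.sub continuousAt_id)
    have h1 := hcont.tendsto.mono_left (nhdsWithin_le_nhds (s := Set.Ioi 0))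
    rw [sub_zero, Real.rpow_one] at h1
    refine h1.congr' ?_
    filter_upwards [self_mem_nhdsWithin] with α hα
    have hα' : α ≠ 0 := (Set.mem_Ioi.1 hα).ne'
    rw [← Real.rpow_natCast, ← Real.rpow_mul hw.le, ← Real.rpow_mul hw.le]
    congr 1
    push_cast
    field_simp
  · refine tendsto_const_nhds.congr' ?_
    filter_upwards [self_mem_nhdsWithin] with α hα
    -- Zero rows contribute nothing only because `α ≠ 0`; in Lean `0 ^ 0 = 1`.
    rw [Real.zero_rpow (Set.mem_Ioi.1 hα).ne']

theorem powTrace_mul_conjTranspose_comm (A : Matrix (Fin d) (Fin d) ℂ) (p : ℝ) :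
    powTrace p (A * Aᴴ) = powTrace p (Aᴴ * A) :=
  powTrace_congr_charpoly
    (Matrix.nonneg_iff_posSemidef.2 (Matrix.posSemidef_self_mul_conjTranspose A))
    (Matrix.nonneg_iff_posSemidef.2 (Matrix.posSemidef_conjTranspose_mul_self A))
    (Matrix.charpoly_mul_comm _ _) p

theorem traceFunctional_self_eq_powTrace {ρ U : Matrix (Fin d) (Fin d) ℂ} (hρ : ρ.PosSemidef)
    (hU : U ∈ Matrix.unitaryGroup (Fin d) ℂ) {ev : Fin d → ℝ} (hpos : ∀ i, 0 < ev i)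
    {α : ℝ} (hα : α ≠ 0) :
    traceFunctional α α ρ (U * Matrix.diagonal (fun i => (ev i : ℂ)) * Uᴴ) =
      powTrace α ((Matrix.diagonal fun i => ((ev i ^ ((1 - α) / (2 * α)) : ℝ) : ℂ)) *
        (Uᴴ * ρ * U) * (Matrix.diagonal fun i => ((ev i ^ ((1 - α) / (2 * α)) : ℝ) : ℂ))ᴴ) := by
  have hUU : Uᴴ * U = 1 := Matrix.mem_unitaryGroup_iff'.1 hU
  have hρ0 := Matrix.nonneg_iff_posSemidef.2 hρ
  have hρ1 : CFC.rpow ρ (α / α) = ρ := by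
    rw [div_self hα]
    exact CFC.rpow_one ρ hρ0
  set D : Matrix (Fin d) (Fin d) ℂ :=
    Matrix.diagonal fun i => ((ev i ^ ((1 - α) / (2 * α)) : ℝ) : ℂ) with hD
  have hDstar : Dᴴ = D := by
    rw [hD, Matrix.diagonal_conjTranspose]
    congr 1
    funext i
    simp only [Pi.star_apply]
    exact Complex.conj_ofReal _
  have hY : 0 ≤ D * (Uᴴ * ρ * U) * Dᴴ :=
    star_right_conjugate_nonneg (star_left_conjugate_nonneg hρ0 U) D
  have hX : U * D * Uᴴ * ρ * (U * D * Uᴴ) = U * (D * (Uᴴ * ρ * U) * Dᴴ) * Uᴴ := by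
    rw [hDstar]
    simp only [Matrix.mul_assoc]
  change powTrace α _ = _
  rw [rpow_conj_diagonal hU (fun i => (hpos i).le), hρ1, hX]
  refine powTrace_congr_charpoly (star_right_conjugate_nonneg hY U) hY ?_ α
  rw [Matrix.charpoly_mul_comm, ← Matrix.mul_assoc, Matrix.star_eq_conjTranspose, hUU,
    Matrix.one_mul]

theorem mul_eq_zero_iff_of_isRowEchelonFormOf {ρ U R : Matrix (Fin d) (Fin d) ℂ}
    (hR : IsRowEchelonFormOf R (supportProj ρ * U)) (M : Matrix (Fin d) (Fin d) ℂ) :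
    R * M = 0 ↔ ρ * (U * M) = 0 := by
  obtain ⟨-, P, hP, rfl⟩ := hR
  rw [← supportProj_mul_eq_zero_iff ρ, Matrix.mul_assoc, Matrix.mul_assoc, hP.mul_right_eq_zero]

theorem tendsto_traceFunctional {ρ U R : Matrix (Fin d) (Fin d) ℂ} (hρ : ρ.PosSemidef)
    (hU : U ∈ Matrix.unitaryGroup (Fin d) ℂ) {ev : Fin d → ℝ} (hpos : ∀ i, 0 < ev i)
    (hev : Antitone ev) (hR : IsRowEchelonFormOf R (supportProj ρ * U)) :
    Tendsto (fun α : ℝ => traceFunctional α α ρ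
      (U * Matrix.diagonal (fun i => (ev i : ℂ)) * Uᴴ)) (𝓝[>] 0)
      (𝓝 (∑ j ∈ pivotColumns R, ev j)) := by
  classical
  have hUU : U * Uᴴ = 1 := Matrix.mem_unitaryGroup_iff.1 hU
  set B := Uᴴ * ρ * U with hB
  have hB0 : 0 ≤ B := star_left_conjugate_nonneg (Matrix.nonneg_iff_posSemidef.2 hρ) U
  have hRR0 : 0 ≤ Rᴴ * R :=
    Matrix.nonneg_iff_posSemidef.2 (Matrix.posSemidef_conjTranspose_mul_self R)
  have hker : ∀ M : Matrix (Fin d) (Fin d) ℂ, Rᴴ * R * M = 0 ↔ B * M = 0 := by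
    intro M
    rw [Matrix.conjTranspose_mul_self_mul_eq_zero, mul_eq_zero_iff_of_isRowEchelonFormOf hR]
    constructor
    · intro h
      rw [hB, Matrix.mul_assoc, Matrix.mul_assoc, h, Matrix.mul_zero]
    · intro h
      have := congrArg (U * ·) h
      simpa [hB, ← Matrix.mul_assoc, hUU] using this
  -- These constants, like `c` and `C` below, do not depend on `α`, so their `α`-th powers tend to
  -- `1`.
  obtain ⟨k₁, hk₁, hle₁⟩ := exists_le_smul_of_ker_le hRR0 hB0 fun M => (hker M).1
  obtain ⟨k₂, hk₂, hle₂⟩ := exists_le_smul_of_ker_le hB0 hRR0 fun M => (hker M).2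
  obtain ⟨c, C, hc, hC, hcC⟩ := exists_eventually_smul_diagonal_le hR.1 hpos hev
  have hT := tendsto_sum_rowWeight_rpow hR.1 hpos
  set T : ℝ → ℝ := fun α => ∑ i, (if ∃ c, R.IsLeadingEntry i c then
        (rowWeight R ev i ^ ((1 - α) / (2 * α))) ^ 2 else 0) ^ α with hTdef
  have hlow : Tendsto (fun α => (k₂ ^ α)⁻¹ * (c ^ α * T α)) (𝓝[>] 0)
      (𝓝 (∑ j ∈ pivotColumns R, ev j)) := by
    have := ((tendsto_const_rpow_nhdsGT_zero hk₂).inv₀ one_ne_zero).mul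
      ((tendsto_const_rpow_nhdsGT_zero hc).mul hT)
    simpa using this
  have hupp : Tendsto (fun α => k₁ ^ α * (C ^ α * T α)) (𝓝[>] 0)
      (𝓝 (∑ j ∈ pivotColumns R, ev j)) := by
    have := (tendsto_const_rpow_nhdsGT_zero hk₁).mul
      ((tendsto_const_rpow_nhdsGT_zero hC).mul hT)
    simpa using this
  have hbounds : ∀ᶠ α in 𝓝[>] (0 : ℝ),
      (k₂ ^ α)⁻¹ * (c ^ α * T α) ≤ traceFunctional α α ρ
        (U * Matrix.diagonal (fun i => (ev i : ℂ)) * Uᴴ) ∧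
      traceFunctional α α ρ (U * Matrix.diagonal (fun i => (ev i : ℂ)) * Uᴴ) ≤
        k₁ ^ α * (C ^ α * T α) := by
    filter_upwards [tendsto_one_sub_div_two_mul.eventually hcC,
      Ioc_mem_nhdsGT (zero_lt_one (α := ℝ))] with α hα hα1
    have hp : α ∈ Set.Icc (0 : ℝ) 1 := ⟨hα1.1.le, hα1.2⟩
    rw [traceFunctional_self_eq_powTrace hρ hU hpos hα1.1.ne', ← hB]
    set D : Matrix (Fin d) (Fin d) ℂ :=
      Matrix.diagonal fun i => ((ev i ^ ((1 - α) / (2 * α)) : ℝ) : ℂ) with hD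
    have hDstar : Dᴴ = D := by
      rw [hD, Matrix.diagonal_conjTranspose]
      congr 1
      funext i
      simp only [Pi.star_apply]
      exact Complex.conj_ofReal _
    have hw : ∀ i, 0 ≤ (if ∃ c, R.IsLeadingEntry i c then
        (rowWeight R ev i ^ ((1 - α) / (2 * α))) ^ 2 else 0 : ℝ) := by
      intro i
      split_ifs
      · positivity
      · exact le_rfl
    have hRD : D * (Rᴴ * R) * Dᴴ = (R * D)ᴴ * (R * D) := by
      rw [Matrix.conjTranspose_mul, hDstar]
      simp only [Matrix.mul_assoc]
    have hRD0 : 0 ≤ D * (Rᴴ * R) * Dᴴ := star_right_conjugate_nonneg hRR0 D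
    have hBD0 : 0 ≤ D * B * Dᴴ := star_right_conjugate_nonneg hB0 D
    have h₁ := powTrace_mono hp (star_right_conjugate_le_conjugate hle₁ D)
    have h₂ := powTrace_mono hp (star_right_conjugate_le_conjugate hle₂ D)
    rw [Matrix.star_eq_conjTranspose, Matrix.mul_smul, Matrix.smul_mul,
      powTrace_smul hRD0 hk₁.le] at h₁
    rw [Matrix.star_eq_conjTranspose, Matrix.mul_smul, Matrix.smul_mul,
      powTrace_smul hBD0 hk₂.le] at h₂
    have h₃ := powTrace_mono hp hα.1
    have h₄ := powTrace_mono hp hα.2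
    rw [powTrace_smul (diagonal_ofReal_nonneg hw) hc.le, powTrace_diagonal hw,
      powTrace_mul_conjTranspose_comm, ← hRD] at h₃
    rw [powTrace_smul (diagonal_ofReal_nonneg hw) hC.le, powTrace_diagonal hw,
      powTrace_mul_conjTranspose_comm, ← hRD] at h₄
    constructor
    · rw [inv_mul_le_iff₀ (Real.rpow_pos_of_pos hk₂ α)]
      exact h₃.trans h₂
    · exact h₁.trans (mul_le_mul_of_nonneg_left h₄ (Real.rpow_pos_of_pos hk₁ α).le)
  exact tendsto_of_tendsto_of_tendsto_of_le_of_le' hlow hupp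
    (hbounds.mono fun _ h => h.1) (hbounds.mono fun _ h => h.2)

/-- Without pivots `R = 0`, hence `ρ = ρ * (U * Uᴴ) = 0`, against trace one. Positivity makes `log₂`
continuous at the limit. -/
theorem sum_pivotColumns_pos {ρ U R : Matrix (Fin d) (Fin d) ℂ}
    (hU : U ∈ Matrix.unitaryGroup (Fin d) ℂ) {ev : Fin d → ℝ} (hpos : ∀ i, 0 < ev i)
    (hR : IsRowEchelonFormOf R (supportProj ρ * U)) (htr : ρ.trace = 1) :
    0 < ∑ j ∈ pivotColumns R, ev j := by
  refine Finset.sum_pos (fun j _ => hpos j) ?_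
  by_contra hne
  have hR0 : R = 0 := by
    ext i j
    refine apply_eq_zero_of_not_exists_isLeadingEntry (fun ⟨c, hc⟩ => hne ⟨c, ?_⟩) j
    simp only [pivotColumns, Finset.mem_filter, Finset.mem_univ, true_and]
    exact ⟨i, hc⟩
  have h := (mul_eq_zero_iff_of_isRowEchelonFormOf hR Uᴴ).1 (by rw [hR0, Matrix.zero_mul])
  have hUU : U * Uᴴ = 1 := Matrix.mem_unitaryGroup_iff.1 hU
  rw [hUU, Matrix.mul_one] at h
  rw [h, Matrix.trace_zero] at htr
  exact zero_ne_one htr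

theorem tendsto_renyiEntropy {ρ σ : Matrix (Fin d) (Fin d) ℂ} {L : ℝ} (hL : L ≠ 0)
    (h : Tendsto (fun α : ℝ => traceFunctional α α ρ σ) (𝓝[>] 0) (𝓝 L)) :
    Tendsto (fun α : ℝ => renyiEntropy α α ρ σ) (𝓝[>] 0) (𝓝 (-Real.logb 2 L)) := by
  have h1 : ContinuousAt (fun α : ℝ => 1 / (α - 1)) 0 :=
    continuousAt_const.div (continuousAt_id.sub continuousAt_const) (by norm_num)
  have h2 := h1.tendsto.mono_left (nhdsWithin_le_nhds (s := Set.Ioi 0))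
  have h3 := h2.mul ((Real.continuousAt_logb (b := 2) hL).tendsto.comp h)
  rwa [zero_sub, div_neg, div_one, neg_one_mul] at h3

end Limit

theorem mainTheorem8 (d : ℕ) (ρ σ : Matrix (Fin d) (Fin d) ℂ)
    (hρ : ρ.PosSemidef) (hσ : σ.PosDef)
    (U : Matrix (Fin d) (Fin d) ℂ) (hU : U ∈ Matrix.unitaryGroup (Fin d) ℂ)
    (ev : Fin d → ℝ) (hev : Antitone ev)
    (hspec : σ = U * Matrix.diagonal (fun i => (ev i : ℂ)) * Uᴴ) :
    (∃ R : Matrix (Fin d) (Fin d) ℂ, IsRowEchelonFormOf R (supportProj ρ * U)) ∧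
    (∀ R : Matrix (Fin d) (Fin d) ℂ, IsRowEchelonFormOf R (supportProj ρ * U) →
      Tendsto (fun α : ℝ => traceFunctional α α ρ σ) (𝓝[>] 0)
        (𝓝 (∑ j ∈ pivotColumns R, ev j)) ∧
      (ρ.trace = 1 →
        Tendsto (fun α : ℝ => renyiEntropy α α ρ σ) (𝓝[>] 0)
          (𝓝 (-Real.logb 2 (∑ j ∈ pivotColumns R, ev j))))) ∧
    (∀ ρ' : Matrix (Fin d) (Fin d) ℂ, ρ'.PosSemidef → supportProj ρ' = supportProj ρ →
      (∃ L : ℝ, Tendsto (fun α : ℝ => traceFunctional α α ρ σ) (𝓝[>] 0) (𝓝 L) ∧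
        Tendsto (fun α : ℝ => traceFunctional α α ρ' σ) (𝓝[>] 0) (𝓝 L)) ∧
      (ρ.trace = 1 → ρ'.trace = 1 →
        ∃ L : ℝ, Tendsto (fun α : ℝ => renyiEntropy α α ρ σ) (𝓝[>] 0) (𝓝 L) ∧
          Tendsto (fun α : ℝ => renyiEntropy α α ρ' σ) (𝓝[>] 0) (𝓝 L))) := by
  have hUu : IsUnit U := (Unitary.toUnits ⟨U, hU⟩).isUnit
  have hpos : ∀ i, 0 < ev i := by
    rw [hspec, ← Matrix.star_eq_conjTranspose, Matrix.IsUnit.posDef_star_right_conjugate_iff hUu,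
      Matrix.posDef_diagonal_iff] at hσ
    exact fun i => by exact_mod_cast hσ i
  have hf : ∀ {ρ R : Matrix (Fin d) (Fin d) ℂ}, ρ.PosSemidef →
      IsRowEchelonFormOf R (supportProj ρ * U) →
      Tendsto (fun α : ℝ => traceFunctional α α ρ σ) (𝓝[>] 0)
        (𝓝 (∑ j ∈ pivotColumns R, ev j)) := by
    intro ρ R hρ hR
    rw [hspec]
    exact tendsto_traceFunctional hρ hU hpos hev hR
  have hD : ∀ {ρ R : Matrix (Fin d) (Fin d) ℂ}, ρ.PosSemidef →
      IsRowEchelonFormOf R (supportProj ρ * U) → ρ.trace = 1 →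
      Tendsto (fun α : ℝ => renyiEntropy α α ρ σ) (𝓝[>] 0)
        (𝓝 (-Real.logb 2 (∑ j ∈ pivotColumns R, ev j))) :=
    fun hρ hR htr => tendsto_renyiEntropy (sum_pivotColumns_pos hU hpos hR htr).ne' (hf hρ hR)
  obtain ⟨R, hR⟩ := exists_isRowEchelonFormOf (supportProj ρ * U)
  refine ⟨⟨R, hR⟩, fun R hR => ⟨hf hρ hR, hD hρ hR⟩, fun ρ' hρ' hsupp => ?_⟩
  -- `ρ` enters the limits only through `R`, so one echelon form serves both matrices.
  have hR' : IsRowEchelonFormOf R (supportProj ρ' * U) := hsupp ▸ hR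
  exact ⟨⟨_, hf hρ hR, hf hρ' hR'⟩, fun htr htr' => ⟨_, hD hρ hR htr, hD hρ' hR' htr'⟩⟩
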